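/- Let $q$ be a prime power, let $m\ge 3$, let $d$ be a divisor of $m$ with $d<m$, and put $n=q^m$ and $r=q^{m-d}-1$. For a finite additively written abelian group $G$ and a set $D\subseteq G$ with $0\notin D$ and $-D=D$, let $\mathrm{Cay}(G,D)$ be the graph on $G$ in which two elements are adjacent iff their difference lies in $D$. (A strongly regular graph is understood to be neither complete nor edgeless.) Then for each $\epsilon\in\{1,-1\}$ there exists a strongly regular Cayley graph with parameters $$(n^2,\; r(n-\epsilon),\; \epsilon n+r^2-3\epsilon r,\; r^2-\epsilon r).$$ More precisely, let $N=\frac{q^m-1}{q^d-1}$, and for a primitive element $\omega$ of $\mathbb F_{q^m}$ let $I_\omega=\{0\le i\le N-1 : \mathrm{Tr}_{\mathbb F_{q^m}/\mathbb F_{q^d}}(\omega^i)=0\}$. Then: 1. ($\epsilon=-1$) If $\gamma$ is a primitive element of $\mathbb F_{q^{2m}}$ and $\omega=\gamma^{q^m+1}$, then $\mathrm{Cay}(\mathbb F_{q^{2m}},E)$ with $E=\bigcup_{i\in I_\omega}\gamma^i\langle\gamma^N\rangle$ is strongly regular with the above parameters for $\epsilon=-1$. 2. ($\epsilon=1$)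 If $\omega$ is a primitive element of $\mathbb F_{q^m}$, then $\mathrm{Cay}(\mathbb F_{q^m}\times\mathbb F_{q^m},H)$ with $H=\{(y,\,y^{-1}x\omega^\ell) : x\in\langle\omega^N\rangle,\ y\in\mathbb F_{q^m}^*,\ \ell\in I_\omega\}$ is strongly regular with the above parameters for $\epsilon=1$. -/

import Mathlib

namespace SingerLift

open Classical in
/-- `IsSRG Γ v k l μ`: the finite simple graph `Γ` is neither complete nor edgeless, and it is
strongly regular with (integer) parameters `(v, k, l, μ)`. The parameters are integers because the
formulas for them involve subtraction; being cardinalities, they are then nonnegative. -/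
def IsSRG {V : Type*} [Fintype V] (Γ : SimpleGraph V) (v k l μ : ℤ) : Prop :=
  Γ ≠ ⊤ ∧ Γ ≠ ⊥ ∧ ∃ v' k' l' μ' : ℕ,
    (v' : ℤ) = v ∧ (k' : ℤ) = k ∧ (l' : ℤ) = l ∧ (μ' : ℤ) = μ ∧ Γ.IsSRGWith v' k' l' μ'

/-- `D` is the connection set of a strongly regular Cayley graph over the additively written
group `G` with parameters `(v, k, l, μ)`: one has `0 ∉ D` and `-D = D` (so that `x, y` are adjacent
in `Cay(G, D)` iff their difference lies in `D`), and `Cay(G, D)` is strongly regular. -/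
def IsSRCayley {G : Type*} [AddCommGroup G] [Fintype G] (D : Set G) (v k l μ : ℤ) : Prop :=
  (0 : G) ∉ D ∧ (∀ x, x ∈ D ↔ -x ∈ D) ∧ IsSRG (SimpleGraph.addCayley D) v k l μ

/-- The same with the parameters
`(n², r(n - ε), εn + r² - 3εr, r² - εr)`: Latin square type for `ε = 1`, negative Latin square
type for `ε = -1`. -/
def IsLatinSRCayley {G : Type*} [AddCommGroup G] [Fintype G] (D : Set G) (ε n r : ℤ) : Prop :=
  IsSRCayley D (n ^ 2) (r * (n - ε)) (ε * n + r ^ 2 - 3 * ε * r) (r ^ 2 - ε * r)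

/-- A primitive element of a finite field: a generator of the multiplicative group. -/
def IsPrimitiveElement {F : Type*} [Field F] (ω : F) : Prop :=
  ω ≠ 0 ∧ ∀ x : F, x ≠ 0 → ∃ t : ℕ, x = ω ^ t

/-- The cyclotomic class `C_j = γ^j ⟨γ^N⟩`, for a primitive element `γ` of a finite field
(where the powers with natural exponents already form the subgroup `⟨γ^N⟩`). -/
def cyclotomicClass {F : Type*} [Field F] (γ : F) (N j : ℕ) : Set F :=
  {x | ∃ t : ℕ, x = γ ^ j * (γ ^ N) ^ t}

/-- The Singer difference set of `F` over the subfield `K`, as a set of exponents modulo `N`: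
`I = {0 ≤ i ≤ N - 1 ∣ Tr_{F/K}(ω^i) = 0}`. -/
def singerSet (K : Type*) {F : Type*} [Field K] [Field F] [Algebra K F] (ω : F) (N : ℕ) : Set ℕ :=
  {i | i < N ∧ Algebra.trace K F (ω ^ i) = 0}

/-- The connection set of the elliptic lifting: `E = ⋃_{i ∈ I} C_i`, where the `C_i` are the
cyclotomic classes of order `N` of the field `L` with respect to `γ`. -/
def ellipticSet {L : Type*} [Field L] (γ : L) (N : ℕ) (I : Set ℕ) : Set L :=
  ⋃ i ∈ I, cyclotomicClass γ N i

/-- The connection set of the hyperbolic lifting: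
`H = {(y, y⁻¹ x ω^ℓ) ∣ x ∈ C_0, y ∈ F^*, ℓ ∈ I}`, with `C_0 = ⟨ω^N⟩`. -/
def hyperbolicSet {F : Type*} [Field F] (ω : F) (N : ℕ) (I : Set ℕ) : Set (F × F) :=
  {z | ∃ x ∈ cyclotomicClass ω N 0, ∃ y : F, y ≠ 0 ∧ ∃ l ∈ I, z = (y, y⁻¹ * x * ω ^ l)}

end SingerLift

/-!
Write `K ⊆ F ⊆ L` for the fields with `p = |K|`, `n = |F| = p s` and `|L| = n²`; thus `r = s - 1`.
Since `ω ^ N = N_{F/K}(ω)` is a nonzero scalar of `K`, whether `Tr_{F/K}(ω ^ j)` vanishes depends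
only on `j` modulo `N`. Hence both connection sets are pieces of quadrics over `K`: the elliptic one
is `{x ≠ 0 ∣ Tr_{F/K}(N_{L/F} x) = 0}` (`mem_ellipticSet_iff`), and the hyperbolic one is
`{(y, z) ∣ y ≠ 0, z ≠ 0, Tr_{F/K}(y z) = 0}` (`mem_hyperbolicSet_iff`), that is, the nonzero zeros of
a hyperbolic form off the two totally singular subspaces `F × 0` and `0 × F`.

Let `Q` be either quadratic form and `β_v` the polar functional of `v`, so that
`Q (x + u v) = Q x + u β_v x + u² Q v`. Common neighbours of `0` and `v` are the `x` with `Q x = 0`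
and `Q (x - v) = 0`, i.e. `Q x = 0` and `β_v x = Q v`, apart from a few excluded points. They are
counted without characters: for fixed `u`, translation by `u v` identifies the solutions of
`Q x + u (β_v x - Q v) = 0` with those of `Q x = u (u + 1) Q v`. Summed over `u`, the first kind
counts a vector `x` once if `β_v x ≠ Q v`, and otherwise `p` times or not at all, according to
whether `Q x = 0`. So the number of common zeros is determined by the sizes of the level sets of `Q`
(`card_mul_card_common_zeros`), and these take only two values, one at `0` and one elsewhere
(`card_common_zeros`). The level sets come from the fibres of the trace and of the norm in the
elliptic case (`card_trace_norm_fiber`) and from those of the trace alone in the hyperbolic case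
(`card_trace_mul_eq`). In the hyperbolic case the points on four coordinate lines still have to be
discarded (`card_sdiff_lines`), and `v` on a coordinate axis is treated directly
(`card_common_hyperbolic_zero`).
-/

namespace SingerLift

section Counting

open scoped Finset Classical

/-! ### Counting zeros of a quadratic form in an affine hyperplane -/

@[to_additive card_mul_card_addMonoidHom_fiber]
theorem card_mul_card_monoidHom_fiber {G H : Type*} [Group G] [Group H] [Fintype G] [Fintype H]
    [DecidableEq H] {f : G →* H} (hf : Function.Surjective f) (a : H) :
    Fintype.card H * #{x | f x = a} = Fintype.card G := by
  have h := Finset.card_eq_sum_card_fiberwise (s := (Finset.univ : Finset G))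
    (t := (Finset.univ : Finset H)) (f := f) (fun _ _ => Finset.mem_coe.2 (Finset.mem_univ _))
  rw [Finset.card_univ] at h
  rw [h, Finset.sum_congr rfl fun b _ =>
    MonoidHom.card_fiber_eq_of_mem_range f (hf b) (hf a)]
  simp

/-- The identity behind all counts of common neighbours: the pairs `(u, x)` with
`Q x + u * (β x - Q v) = 0` are counted once by `x` and once by `u`. -/
theorem card_mul_card_common_zeros {K V : Type*} [Field K] [Fintype K] [AddCommGroup V] [Module K V]
    [Fintype V] (Q : V → K) (β : V → K) (v : V)
    (hQ : ∀ x (u : K), Q (x + u • v) = Q x + u * β x + u ^ 2 * Q v) :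
    Fintype.card K * #{x | Q x = 0 ∧ β x = Q v} + Fintype.card V =
      #{x | β x = Q v} + ∑ u : K, #{x | Q x = u * (u + 1) * Q v} := by
  have h1 : ∀ u : K, #{x | Q x = u * (u + 1) * Q v} = #{x | Q x + u * (β x - Q v) = 0} := by
    intro u
    -- translation by `u • v` turns the second equation into the first
    refine (Finset.card_equiv (Equiv.addRight (u • v)) fun x => ?_).symm
    simp only [Finset.mem_filter, Finset.mem_univ, true_and, Equiv.coe_addRight, hQ]
    constructor <;> intro h <;> linear_combination h
  have h2 : ∑ u : K, #{x | Q x + u * (β x - Q v) = 0} =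
      ∑ x : V, #{u : K | Q x + u * (β x - Q v) = 0} := by
    simp only [Finset.card_filter]
    exact Finset.sum_comm
  have h3 : ∀ x : V, #{u : K | Q x + u * (β x - Q v) = 0} + (if β x = Q v then 1 else 0) =
      1 + (if Q x = 0 ∧ β x = Q v then Fintype.card K else 0) := by
    intro x
    by_cases hb : β x = Q v
    · by_cases hx : Q x = 0 <;> simp [hb, hx, add_comm]
    · have hb' : β x - Q v ≠ 0 := sub_ne_zero.2 hb
      have : ∀ u : K, Q x + u * (β x - Q v) = 0 ↔ u = -Q x / (β x - Q v) := by
        intro u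
        rw [eq_div_iff hb']
        constructor <;> intro h <;> linear_combination h
      have h1 : #{u : K | Q x + u * (β x - Q v) = 0} = 1 :=
        Finset.card_eq_one.2 ⟨-Q x / (β x - Q v), by ext u; simp [this]⟩
      simp [h1, hb]
  have h4 := Finset.sum_congr (rfl : (Finset.univ : Finset V) = _) fun x _ => h3 x
  rw [Finset.sum_add_distrib, Finset.sum_add_distrib] at h4
  rw [Finset.sum_congr rfl fun u _ => h1 u, h2]
  have h5 : ∑ x : V, (if β x = Q v then 1 else 0) = #{x | β x = Q v} := by simp
  have h6 : ∑ x : V, (if Q x = 0 ∧ β x = Q v then Fintype.card K else 0) =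
      Fintype.card K * #{x | Q x = 0 ∧ β x = Q v} := by
    rw [← Finset.sum_filter]; simp [mul_comm]
  rw [h5, h6] at h4
  simp only [Finset.sum_const, Finset.card_univ, smul_eq_mul, mul_one] at h4
  omega

/-- The number of common zeros when the level sets of `Q` have the sizes occurring for a
nondegenerate quadratic form of type `ε` (`1` hyperbolic, `-1` elliptic) on a space with `(p * s) ^ 2`
elements over a field with `p` elements. -/
theorem card_common_zeros {K V : Type*} [Field K] [Fintype K] [AddCommGroup V] [Module K V]
    [Fintype V] (Q : V → K) (β : V →+ K) (hβ : Function.Surjective β) (v : V)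
    (hQ : ∀ x (u : K), Q (x + u • v) = Q x + u * β x + u ^ 2 * Q v)
    {p s ε : ℤ} (hp : (Fintype.card K : ℤ) = p) (hV : (Fintype.card V : ℤ) = (p * s) ^ 2)
    (h0 : (#{x | Q x = 0} : ℤ) = p * s * s + ε * (p * s - s))
    (h1 : ∀ a ≠ 0, (#{x | Q x = a} : ℤ) = p * s * s - ε * s) :
    (#{x | Q x = 0 ∧ β x = Q v} : ℤ) =
      if Q v = 0 then s ^ 2 + ε * (p * s - s) else s ^ 2 + ε * s := by
  have hp0 : p ≠ 0 := by rw [← hp]; exact_mod_cast Fintype.card_ne_zero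
  have hc := card_mul_card_common_zeros Q β v hQ
  have hf := card_mul_card_addMonoidHom_fiber hβ (Q v)
  zify at hc hf
  rw [hp, hV] at hc hf
  have hf' : (#{x | β x = Q v} : ℤ) = p * s ^ 2 := by
    apply mul_left_cancel₀ hp0; rw [hf]; ring
  rw [hf'] at hc
  apply mul_left_cancel₀ hp0
  split_ifs with hv
  · simp only [hv, mul_zero, h0, Finset.sum_const, Finset.card_univ, nsmul_eq_mul, hp] at hc ⊢
    linear_combination hc
  · -- `u * (u + 1) * Q v` vanishes exactly for the two distinct values `u = 0` and `u = -1`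
    have hsum : ∑ u : K, (#{x | Q x = u * (u + 1) * Q v} : ℤ) =
        ∑ u : K, ((p * s * s - ε * s) + ((if u = 0 then ε * (p * s) else 0) +
          (if u = -1 then ε * (p * s) else 0))) := by
      refine Finset.sum_congr rfl fun u _ => ?_
      by_cases hu : u = 0
      · simp [hu, h0]; ring
      by_cases hu' : u = -1
      · simp [hu', h0]; ring
      · rw [h1 _ (mul_ne_zero (mul_ne_zero hu fun h => hu' (eq_neg_of_add_eq_zero_left h)) hv)]
        simp [hu, hu']
    rw [hsum] at hc
    simp [Finset.sum_add_distrib, hp] at hc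
    linear_combination hc

/-! ### Cayley graphs from counts in the connection set -/

/-- Strong regularity of a Cayley graph only needs the number of common neighbours of `0` and `v`.
The two bounds on the valency exclude the edgeless and the complete graph. -/
theorem isLatinSRCayley_of_card {G : Type*} [AddCommGroup G] [Fintype G] {D : Set G} {ε n r : ℤ}
    (h0 : (0 : G) ∉ D) (hneg : ∀ x ∈ D, -x ∈ D) (hG : (Fintype.card G : ℤ) = n ^ 2)
    (hD : (#{x | x ∈ D} : ℤ) = r * (n - ε))
    (hadj : ∀ v ∈ D, (#{x | x ∈ D ∧ x - v ∈ D} : ℤ) = ε * n + r ^ 2 - 3 * ε * r)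
    (hnadj : ∀ v ∉ D, v ≠ 0 → (#{x | x ∈ D ∧ x - v ∈ D} : ℤ) = r ^ 2 - ε * r)
    (hpos : 0 < r * (n - ε)) (hlt : r * (n - ε) < n ^ 2 - 1) :
    IsLatinSRCayley D ε n r := by
  have hneg' : ∀ x, x ∈ D ↔ -x ∈ D := fun x => ⟨hneg x, fun h => neg_neg x ▸ hneg _ h⟩
  have hAdj : ∀ v w, (SimpleGraph.addCayley D).Adj v w ↔ w - v ∈ D := by
    intro v w
    rw [SimpleGraph.addCayley_adj, neg_add_eq_sub, neg_add_eq_sub, hneg' (v - w), neg_sub, or_self]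
    refine ⟨And.right, fun h => ⟨?_, h⟩⟩
    rintro rfl
    exact h0 (by simpa using h)
  obtain ⟨a, ha⟩ : ∃ a, a ∈ D := by
    by_contra! h
    simp only [h, Finset.filter_false, Finset.card_empty] at hD
    push_cast at hD
    omega
  obtain ⟨b, hb, hb0⟩ : ∃ b, b ∉ D ∧ b ≠ 0 := by
    by_contra! h
    have h1 : (Finset.univ : Finset G) ⊆ insert 0 (Finset.univ.filter (· ∈ D)) := by
      intro x _
      by_cases hx : x ∈ D
      · simp [hx]
      · simp [h x hx]
    have h2 := (Finset.card_le_card h1).trans (Finset.card_insert_le _ _)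
    rw [Finset.card_univ] at h2
    zify at h2
    omega
  have hcommon : ∀ v w, Fintype.card ((SimpleGraph.addCayley D).commonNeighbors v w) =
      #{x | x ∈ D ∧ x - (w - v) ∈ D} := by
    intro v w
    rw [← Set.toFinset_card]
    refine Finset.card_equiv (Equiv.subRight v) fun x => ?_
    simp only [Set.mem_toFinset, SimpleGraph.mem_commonNeighbors, hAdj, Finset.mem_filter,
      Finset.mem_univ, true_and, Equiv.subRight_apply, sub_sub_sub_cancel_right]
  have hreg : ∀ v, #{x | (SimpleGraph.addCayley D).Adj v x} = #{x | x ∈ D} := fun v =>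
    Finset.card_equiv (Equiv.subRight v) fun x => by simp [hAdj]
  have hsrg : (SimpleGraph.addCayley D).IsSRGWith (Fintype.card G) #{x | x ∈ D}
      #{x | x ∈ D ∧ x - a ∈ D} #{x | x ∈ D ∧ x - b ∈ D} := by
    refine ⟨rfl, fun v => ?_, fun v w h => ?_, fun v w hne h => ?_⟩
    · rw [← hreg v, ← SimpleGraph.card_neighborFinset_eq_degree]
      congr 1
      ext x
      simp
    · rw [hcommon]
      have := hadj _ ((hAdj v w).1 h)
      rw [← hadj a ha] at this
      exact_mod_cast this
    · rw [hcommon]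
      have := hnadj (w - v) (fun h' => h ((hAdj v w).2 h')) (sub_ne_zero.2 hne.symm)
      rw [← hnadj b hb hb0] at this
      exact_mod_cast this
  refine ⟨h0, hneg', fun h => ?_, fun h => ?_, Fintype.card G, #{x | x ∈ D},
    #{x | x ∈ D ∧ x - a ∈ D}, #{x | x ∈ D ∧ x - b ∈ D}, hG, hD, hadj a ha, hnadj b hb hb0,
    by convert! hsrg⟩
  · have := (hAdj 0 b).1 (by rw [h]; exact hb0.symm)
    exact hb (by simpa using this)
  · have := (hAdj 0 a).2 (by simpa using ha)
    rw [h] at this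
    exact this

theorem card_trace_fiber {K F : Type*} [Field K] [Field F] [Fintype K] [Fintype F] [Algebra K F]
    {p s : ℤ} (hp : (Fintype.card K : ℤ) = p) (hn : (Fintype.card F : ℤ) = p * s) (a : K) :
    (#{x : F | Algebra.trace K F x = a} : ℤ) = s := by
  have hp0 : p ≠ 0 := by rw [← hp]; exact_mod_cast Fintype.card_ne_zero
  have h := card_mul_card_addMonoidHom_fiber (f := (Algebra.trace K F).toAddMonoidHom)
    (Algebra.trace_surjective K F) a
  zify at h
  rw [hp, hn] at h
  exact mul_left_cancel₀ hp0 h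

/-! ### The elliptic quadric `Tr (N x) = 0` -/

section Elliptic

variable {F L : Type*} [Field F] [Field L] [Fintype F] [Fintype L] [Algebra F L]

theorem algebraMap_norm_of_finrank_two (h2 : Module.finrank F L = 2) (x : L) :
    algebraMap F L (Algebra.norm F x) = x * x ^ Fintype.card F := by
  rw [FiniteField.algebraMap_norm_eq_prod_pow, h2, Nat.card_eq_fintype_card]
  simp [Finset.prod_range_succ]

theorem algebraMap_trace_of_finrank_two (h2 : Module.finrank F L = 2) (x : L) :
    algebraMap F L (Algebra.trace F L x) = x + x ^ Fintype.card F := by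
  rw [FiniteField.algebraMap_trace_eq_sum_pow, h2, Nat.card_eq_fintype_card]
  simp [Finset.sum_range_succ]

/-- In a quadratic extension the norm is a quadratic form, with polar form
`(x, v) ↦ Tr (x * v ^ |F|)`. -/
theorem norm_add_smul (h2 : Module.finrank F L = 2) (x v : L) (c : F) :
    Algebra.norm F (x + c • v) = Algebra.norm F x
      + c * Algebra.trace F L (x * v ^ Fintype.card F) + c ^ 2 * Algebra.norm F v := by
  apply (algebraMap F L).injective
  have hvv : (v ^ Fintype.card F) ^ Fintype.card F = v := by
    rw [← pow_mul, ← sq, ← h2, ← Module.card_eq_pow_finrank, FiniteField.pow_card]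
  simp only [map_add, map_mul, map_pow, algebraMap_norm_of_finrank_two h2,
    algebraMap_trace_of_finrank_two h2, mul_pow, hvv]
  have hadd : (x + c • v) ^ Fintype.card F = x ^ Fintype.card F + c • v ^ Fintype.card F := by
    have := map_add (FiniteField.frobeniusAlgEquivOfAlgebraic F L) x (c • v)
    rwa [map_smul, FiniteField.coe_frobeniusAlgEquivOfAlgebraic] at this
  rw [hadd, Algebra.smul_def, Algebra.smul_def]
  ring

theorem card_norm_fiber (h2 : Module.finrank F L = 2) {a : F} (ha : a ≠ 0) :
    #{x : L | Algebra.norm F x = a} = Fintype.card F + 1 := by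
  have h := card_mul_card_monoidHom_fiber (FiniteField.unitsMap_norm_surjective F L) (Units.mk0 a ha)
  have hb : #{x : Lˣ | Units.map (Algebra.norm F) x = Units.mk0 a ha} =
      #{x : L | Algebra.norm F x = a} := by
    refine Finset.card_bij (fun x _ => (x : L)) (fun x hx => ?_) (fun x _ y _ h => Units.ext h)
      fun x hx => ?_
    · simpa [Units.ext_iff] using hx
    · have hx' : Algebra.norm F x = a := by simpa using hx
      have hx0 : x ≠ 0 := by
        rintro rfl
        exact ha (by rw [← hx', Algebra.norm_zero])
      exact ⟨Units.mk0 x hx0, by simpa [Units.ext_iff] using hx', rfl⟩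
  have hF : 1 < Fintype.card F := Fintype.one_lt_card
  rw [hb, Fintype.card_units, Fintype.card_units, Module.card_eq_pow_finrank (K := F) (V := L),
    h2] at h
  apply Nat.eq_of_mul_eq_mul_left (Nat.sub_pos_of_lt hF)
  rw [h]
  obtain ⟨k, hk⟩ := Nat.exists_eq_add_of_lt hF
  -- `|F| ^ 2 - 1 = (|F| - 1) * (|F| + 1)`, with truncated subtraction
  rw [hk, show (1 + k + 1) ^ 2 = (1 + k) * (1 + k + 1 + 1) + 1 by ring]
  simp

theorem card_trace_norm_fiber {K : Type*} [Field K] [Fintype K] [Algebra K F]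
    (h2 : Module.finrank F L = 2) {p s : ℤ} (hp : (Fintype.card K : ℤ) = p)
    (hn : (Fintype.card F : ℤ) = p * s) (a : K) :
    (#{x : L | Algebra.trace K F (Algebra.norm F x) = a} : ℤ) =
      (p * s + 1) * s - if a = 0 then p * s else 0 := by
  have h := Finset.card_eq_sum_card_fiberwise
    (s := ({x : L | Algebra.trace K F (Algebra.norm F x) = a} : Finset L))
    (t := ({y : F | Algebra.trace K F y = a} : Finset F)) (f := Algebra.norm F)
    (fun x hx => by simpa using hx)
  have h' : ∀ y ∈ ({y : F | Algebra.trace K F y = a} : Finset F),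
      (#{x ∈ ({x : L | Algebra.trace K F (Algebra.norm F x) = a} : Finset L) |
        Algebra.norm F x = y} : ℤ) = (p * s + 1) - if y = 0 then p * s else 0 := by
    intro y hy
    have hy' : Algebra.trace K F y = a := by simpa using hy
    have : ({x ∈ ({x : L | Algebra.trace K F (Algebra.norm F x) = a} : Finset L) |
        Algebra.norm F x = y}) = ({x : L | Algebra.norm F x = y} : Finset L) := by
      ext x
      simp only [Finset.mem_filter, Finset.mem_univ, true_and, and_iff_right_iff_imp]
      rintro rfl
      exact hy'
    rw [this]
    split_ifs with hy0
    · have : #{x : L | Algebra.norm F x = y} = 1 := Finset.card_eq_one.2 ⟨0, by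
        ext x
        simp [hy0, Algebra.norm_eq_zero_iff]⟩
      rw [this]
      push_cast
      ring
    · rw [card_norm_fiber h2 hy0]
      push_cast
      rw [hn]
      ring
  zify at h
  rw [h, Finset.sum_congr rfl h', Finset.sum_sub_distrib]
  simp only [Finset.sum_const, nsmul_eq_mul, card_trace_fiber hp hn a, Finset.sum_ite_eq',
    Finset.mem_filter, Finset.mem_univ, true_and, map_zero, eq_comm (a := (0 : K))]
  ring

/-- The nonzero zeros of the elliptic quadratic form `x ↦ Tr (N x)` on `L` over `K` form a
connection set of negative Latin square type. -/
theorem isLatinSRCayley_elliptic {K : Type*} [Field K] [Fintype K] [Algebra K F]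
    (h2 : Module.finrank F L = 2) {p s : ℤ} (hp : (Fintype.card K : ℤ) = p)
    (hn : (Fintype.card F : ℤ) = p * s) (hs : 2 ≤ s)
    {D : Set L} (hD : ∀ x, x ∈ D ↔ x ≠ 0 ∧ Algebra.trace K F (Algebra.norm F x) = 0) :
    IsLatinSRCayley D (-1) (p * s) (s - 1) := by
  -- `L` carries no `K`-algebra structure a priori: `K` acts through `F`
  let : Module K L := Module.compHom L (algebraMap K F)
  set Q : L → K := fun x => Algebra.trace K F (Algebra.norm F x) with hQdef
  have hQ0 : Q 0 = 0 := by simp [hQdef]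
  let β : L → L →+ K := fun v => (Algebra.trace K F).toAddMonoidHom.comp
    ((Algebra.trace F L).toAddMonoidHom.comp (AddMonoidHom.mulRight (v ^ Fintype.card F)))
  have hQ : ∀ v x (u : K), Q (x + u • v) = Q x + u * β v x + u ^ 2 * Q v := by
    intro v x u
    have h : x + u • v = x + algebraMap K F u • v := rfl
    have h3 : β v x = Algebra.trace K F (Algebra.trace F L (x * v ^ Fintype.card F)) := rfl
    simp only [hQdef]
    rw [h, norm_add_smul h2, h3, ← map_pow, ← Algebra.smul_def, ← Algebra.smul_def, map_add,
      map_add, map_smul, map_smul, smul_eq_mul, smul_eq_mul]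
  have hβ : ∀ v ≠ 0, Function.Surjective (β v) := by
    intro v hv
    refine (Algebra.trace_surjective K F).comp ((Algebra.trace_surjective F L).comp fun y =>
      ⟨y / v ^ Fintype.card F, ?_⟩)
    exact div_mul_cancel₀ _ (pow_ne_zero _ hv)
  have hL : (Fintype.card L : ℤ) = (p * s) ^ 2 := by
    rw [Module.card_eq_pow_finrank (K := F) (V := L), h2]
    push_cast
    rw [hn]
  have hc := card_trace_norm_fiber (K := K) (L := L) h2 hp hn
  have hp2 : 2 ≤ p := by
    rw [← hp]
    exact_mod_cast (Fintype.one_lt_card : 1 < Fintype.card K)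
  have key := fun v hv => card_common_zeros Q (β v) (hβ v hv) v (hQ v) hp hL (ε := -1)
    (by rw [hc 0, if_pos rfl]; ring) (fun a ha => by rw [hc a, if_neg ha]; ring)
  have hsub : ∀ v x, Q (x - v) = Q x - β v x + Q v := by
    intro v x
    have := hQ v x (-1)
    rw [neg_one_smul, ← sub_eq_add_neg] at this
    rw [this]
    ring
  have hself : ∀ v, β v v = 2 * Q v := by
    intro v
    have := hsub v v
    rw [sub_self, hQ0] at this
    linear_combination this
  have hneg : ∀ v, Q (-v) = Q v := by
    intro v
    have := hsub v 0
    simpa [hQ0] using this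
  replace hD : ∀ x, x ∈ D ↔ x ≠ 0 ∧ Q x = 0 := hD
  refine isLatinSRCayley_of_card (by simp [hD])
    (fun x hx => (hD _).2 ⟨neg_ne_zero.2 ((hD x).1 hx).1, ?_⟩) hL ?_ ?_ ?_ ?_ ?_
  · exact (hneg x).trans ((hD x).1 hx).2
  · have : #{x | Q x = 0} = #{x : L | x ∈ D} + 1 := by
      rw [← Finset.card_erase_add_one (a := 0) (by simp [hQ0])]
      congr 2
      ext x
      simp [hD]
    have h0 := hc 0
    rw [if_pos rfl] at h0
    change (#{x | Q x = 0} : ℤ) = _ at h0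
    rw [this] at h0
    push_cast at h0
    linear_combination h0
  · intro v hvD
    obtain ⟨hv, hv0⟩ := (hD v).1 hvD
    -- for singular `v` the points `0` and `v` are common zeros, but not common neighbours
    have h1 : #{x | Q x = 0 ∧ β v x = Q v} =
        #{x : L | x ∈ D ∧ x - v ∈ D} + 1 + 1 := by
      rw [← Finset.card_erase_add_one (a := 0) (by simp [hQ0, hv0]),
        ← Finset.card_erase_add_one (a := v) (by simp [hv, hself, hv0])]
      congr 3
      ext x
      simp only [Finset.mem_erase, Finset.mem_filter, Finset.mem_univ, true_and, hD,
        hsub, hv0, sub_ne_zero]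
      constructor
      · rintro ⟨a, b, c, d⟩
        exact ⟨⟨b, c⟩, a, by simp [c, d]⟩
      · rintro ⟨⟨b, c⟩, a, d⟩
        exact ⟨a, b, c, by simpa [c] using d⟩
    have h2 := key v hv
    rw [if_pos hv0, h1] at h2
    push_cast at h2
    linear_combination h2
  · intro v hvD hv
    have hv0 : Q v ≠ 0 := fun h => hvD ((hD v).2 ⟨hv, h⟩)
    have h1 : #{x | Q x = 0 ∧ β v x = Q v} =
        #{x : L | x ∈ D ∧ x - v ∈ D} := by
      congr 1
      ext x
      simp only [Finset.mem_filter, Finset.mem_univ, true_and, hD, hsub, sub_ne_zero]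
      constructor
      · rintro ⟨c, d⟩
        refine ⟨⟨?_, c⟩, ?_, by simp [c, d]⟩
        · rintro rfl
          exact hv0 (by rw [← d, map_zero])
        · rintro rfl
          exact hv0 c
      · rintro ⟨⟨b, c⟩, a, d⟩
        refine ⟨c, ?_⟩
        rw [c] at d
        linear_combination -d
    have h2 := key v hv
    rw [if_neg hv0, h1] at h2
    linear_combination h2
  · nlinarith
  · nlinarith [mul_nonneg (by omega : 0 ≤ p - 2) (by omega : 0 ≤ s)]
end Elliptic

/-! ### The hyperbolic quadric `Tr (y z) = 0` off the axes -/

section Hyperbolic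

theorem card_filter_prod {α β : Type*} [Fintype α] [Fintype β] (P : α → β → Prop)
    [∀ y, DecidablePred (P y)] [DecidablePred fun z : α × β => P z.1 z.2] :
    #{z : α × β | P z.1 z.2} = ∑ y, #{z | P y z} := by
  simp only [Finset.card_filter, Fintype.sum_prod_type]
  congr!

variable {K F : Type*} [Field K] [Field F] [Fintype K] [Fintype F] [Algebra K F] {p s : ℤ}

theorem card_trace_mul_fiber (hp : (Fintype.card K : ℤ) = p)
    (hn : (Fintype.card F : ℤ) = p * s) {y : F} (hy : y ≠ 0) (a : K) :
    (#{z : F | Algebra.trace K F (y * z) = a} : ℤ) = s := by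
  rw [← card_trace_fiber (F := F) hp hn a]
  congr 1
  exact Finset.card_equiv (Equiv.mulLeft₀ y hy) fun x => by simp

theorem card_trace_mul_eq (hp : (Fintype.card K : ℤ) = p)
    (hn : (Fintype.card F : ℤ) = p * s) (a : K) :
    (#{z : F × F | Algebra.trace K F (z.1 * z.2) = a} : ℤ) =
      p * s * s - s + if a = 0 then p * s else 0 := by
  rw [card_filter_prod fun y z : F => Algebra.trace K F (y * z) = a]
  push_cast
  have h : ∀ y : F, (#{z : F | Algebra.trace K F (y * z) = a} : ℤ) =
      s + if y = 0 then ((if a = 0 then p * s else 0) - s) else 0 := by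
    intro y
    split_ifs with hy ha
    · simp [hy, ha, hn]
    · simp [hy, Ne.symm ha]
    · simp [card_trace_mul_fiber hp hn hy]
  rw [Finset.sum_congr rfl fun y _ => h y]
  simp [Finset.sum_add_distrib, hn]
  ring

/-- Inclusion-exclusion for removing the two vertical lines `a`, `a'` and the two horizontal lines
`b`, `b'` from a subset of a product: parallel lines are disjoint, so only the four crossing points
are added back. -/
theorem card_sdiff_lines {α β : Type*} [Fintype α] [Fintype β] [DecidableEq α] [DecidableEq β]
    (P : α → β → Prop) [∀ y z, Decidable (P y z)] {a a' : α} {b b' : β} (ha : a ≠ a') (hb : b ≠ b') :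
    (#{z : α × β | P z.1 z.2 ∧ z.1 ≠ a ∧ z.1 ≠ a' ∧ z.2 ≠ b ∧ z.2 ≠ b'} : ℤ) =
      #{z : α × β | P z.1 z.2} - #{z | P a z} - #{z | P a' z} - #{y | P y b} - #{y | P y b'}
        + (if P a b then 1 else 0) + (if P a b' then 1 else 0) + (if P a' b then 1 else 0)
        + (if P a' b' then 1 else 0) := by
  have h : ∀ y z, (if P y z ∧ y ≠ a ∧ y ≠ a' ∧ z ≠ b ∧ z ≠ b' then 1 else 0 : ℤ) =
      (if P y z then 1 else 0) - (if y = a then (if P a z then 1 else 0) else 0)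
      - (if y = a' then (if P a' z then 1 else 0) else 0)
      - (if z = b then (if P y b then 1 else 0) else 0)
      - (if z = b' then (if P y b' then 1 else 0) else 0)
      + (if y = a then (if z = b then (if P a b then 1 else 0) else 0) else 0)
      + (if y = a then (if z = b' then (if P a b' then 1 else 0) else 0) else 0)
      + (if y = a' then (if z = b then (if P a' b then 1 else 0) else 0) else 0)
      + (if y = a' then (if z = b' then (if P a' b' then 1 else 0) else 0) else 0) := by
    intro y z
    by_cases hya : y = a
    · subst hya
      by_cases hzb : z = b
      · subst hzb; simp [ha, hb]
      · by_cases hzb' : z = b'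
        · subst hzb'; simp [ha, hzb]
        · simp [ha, hzb, hzb']
    · by_cases hya' : y = a'
      · subst hya'
        by_cases hzb : z = b
        · subst hzb; simp [hya, hb]
        · by_cases hzb' : z = b'
          · subst hzb'; simp [hya, hzb]
          · simp [hya, hzb, hzb']
      · by_cases hzb : z = b
        · subst hzb; simp [hya, hya', hb]
        · by_cases hzb' : z = b'
          · subst hzb'; simp [hya, hya', hzb]
          · simp [hya, hya', hzb, hzb']
  simp only [Finset.card_filter, Fintype.sum_prod_type]
  push_cast
  simp only [h, Finset.sum_add_distrib, Finset.sum_sub_distrib, Finset.sum_ite_eq',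
    Finset.mem_univ, if_true, Finset.sum_ite_irrel, Finset.sum_const_zero]

/-- The common neighbours of `0` and `(0, b)`. For them the two trace conditions say
`Tr (y * b) = 0` and `Tr (y * z) = 0`, which leaves `s - 1` choices of `y` and, for each, `s - 2`
choices of `z`. -/
theorem card_common_hyperbolic_zero (hp : (Fintype.card K : ℤ) = p)
    (hn : (Fintype.card F : ℤ) = p * s) {b : F} (hb : b ≠ 0) :
    (#{z : F × F | (z.1 ≠ 0 ∧ z.2 ≠ 0 ∧ Algebra.trace K F (z.1 * z.2) = 0) ∧ z.2 ≠ b ∧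
      Algebra.trace K F (z.1 * (z.2 - b)) = 0} : ℤ) = (s - 1) * (s - 2) := by
  rw [card_filter_prod fun y z : F => (y ≠ 0 ∧ z ≠ 0 ∧ Algebra.trace K F (y * z) = 0) ∧ z ≠ b ∧
      Algebra.trace K F (y * (z - b)) = 0]
  push_cast
  have h : ∀ y : F, (#{z : F | (y ≠ 0 ∧ z ≠ 0 ∧ Algebra.trace K F (y * z) = 0) ∧ z ≠ b ∧
      Algebra.trace K F (y * (z - b)) = 0} : ℤ) =
      (s - 2) * ((if Algebra.trace K F (b * y) = 0 then 1 else 0) - if y = 0 then 1 else 0) := by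
    intro y
    by_cases hy : y = 0
    · simp [hy]
    by_cases ht : Algebra.trace K F (b * y) = 0
    · have h1 := card_trace_mul_fiber hp hn hy 0
      rw [← Finset.card_erase_add_one (a := 0) (by simp),
        ← Finset.card_erase_add_one (a := b) (by simp [hb, mul_comm y b, ht])] at h1
      have h2 : ({z : F | (y ≠ 0 ∧ z ≠ 0 ∧ Algebra.trace K F (y * z) = 0) ∧ z ≠ b ∧
          Algebra.trace K F (y * (z - b)) = 0} : Finset F) =
          (({z : F | Algebra.trace K F (y * z) = 0} : Finset F).erase 0).erase b := by
        ext z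
        simp only [Finset.mem_filter, Finset.mem_erase, Finset.mem_univ, true_and, mul_sub,
          map_sub, mul_comm y b, ht]
        simp only [sub_zero]
        tauto
      rw [h2, if_pos ht, if_neg hy]
      push_cast at h1
      linear_combination h1
    · rw [if_neg ht, if_neg hy, Finset.card_eq_zero.2]
      · simp
      · ext z
        simp only [Finset.mem_filter, Finset.mem_univ, true_and, mul_sub, map_sub, mul_comm y b,
          Finset.notMem_empty, iff_false]
        rintro ⟨⟨-, -, h⟩, -, h'⟩
        rw [h, zero_sub, neg_eq_zero] at h'
        exact ht h'
  rw [Finset.sum_congr rfl fun y _ => h y, ← Finset.mul_sum, Finset.sum_sub_distrib]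
  have h1 := card_trace_mul_fiber hp hn hb 0
  rw [Finset.card_filter] at h1
  push_cast at h1
  rw [h1]
  simp
  ring

/-- The zeros of the hyperbolic quadratic form `(y, z) ↦ Tr (y * z)` on `F × F` over `K` with both
coordinates nonzero form a connection set of Latin square type. -/
theorem isLatinSRCayley_hyperbolic (hp : (Fintype.card K : ℤ) = p)
    (hn : (Fintype.card F : ℤ) = p * s) (hs : 2 ≤ s) {D : Set (F × F)}
    (hD : ∀ z, z ∈ D ↔ z.1 ≠ 0 ∧ z.2 ≠ 0 ∧ Algebra.trace K F (z.1 * z.2) = 0) :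
    IsLatinSRCayley D 1 (p * s) (s - 1) := by
  set Q : F × F → K := fun z => Algebra.trace K F (z.1 * z.2) with hQdef
  let β : F × F → F × F →+ K := fun v => (Algebra.trace K F).toAddMonoidHom.comp
    ((AddMonoidHom.mulRight v.2).coprod (AddMonoidHom.mulRight v.1))
  have hβ_apply : ∀ v z, β v z = Algebra.trace K F (z.1 * v.2 + z.2 * v.1) := fun _ _ => rfl
  have hQ : ∀ v x (u : K), Q (x + u • v) = Q x + u * β v x + u ^ 2 * Q v := by
    intro v x u
    have : (x + u • v).1 * (x + u • v).2 =
        x.1 * x.2 + u • (x.1 * v.2 + x.2 * v.1) + u ^ 2 • (v.1 * v.2) := by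
      simp only [Prod.fst_add, Prod.snd_add, Prod.smul_fst, Prod.smul_snd]
      simp only [Algebra.smul_def, map_pow]
      ring
    simp only [hQdef]
    rw [this, hβ_apply, map_add, map_add, map_smul, map_smul, smul_eq_mul, smul_eq_mul]
  have hβ : ∀ v, v.2 ≠ 0 → Function.Surjective (β v) := by
    intro v hv
    refine (Algebra.trace_surjective K F).comp fun y => ⟨(y / v.2, 0), ?_⟩
    simp [hv]
  have hV : (Fintype.card (F × F) : ℤ) = (p * s) ^ 2 := by
    rw [Fintype.card_prod]
    push_cast
    rw [hn, sq]
  have hc := card_trace_mul_eq (K := K) (F := F) hp hn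
  have hp2 : 2 ≤ p := by
    rw [← hp]
    exact_mod_cast (Fintype.one_lt_card : 1 < Fintype.card K)
  have hcard : ∀ y : F, y ≠ 0 → (#{z : F | z ≠ 0 ∧ Algebra.trace K F (y * z) = 0} : ℤ) = s - 1 := by
    intro y hy
    have h1 := card_trace_mul_fiber hp hn hy 0
    rw [← Finset.card_erase_add_one (a := 0) (by simp)] at h1
    have h2 : ({z : F | z ≠ 0 ∧ Algebra.trace K F (y * z) = 0} : Finset F) =
        ({z : F | Algebra.trace K F (y * z) = 0} : Finset F).erase 0 := by
      ext z; simp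
    rw [h2]
    push_cast at h1
    linear_combination h1
  have hsub : ∀ v x, Q (x - v) = Q x - β v x + Q v := by
    intro v x
    have := hQ v x (-1)
    rw [neg_one_smul, ← sub_eq_add_neg] at this
    rw [this]
    ring
  have hcommon : ∀ v : F × F, v.1 ≠ 0 → v.2 ≠ 0 →
      (#{x | x ∈ D ∧ x - v ∈ D} : ℤ) = #{x | Q x = 0 ∧ β v x = Q v} - 4 * s + 2
        + 2 * if Q v = 0 then 1 else 0 := by
    rintro ⟨a, b⟩ ha hb
    change a ≠ 0 at ha
    change b ≠ 0 at hb
    have h1 : #{x | x ∈ D ∧ x - (a, b) ∈ D} =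
        #{x : F × F | (Q (x.1, x.2) = 0 ∧ β (a, b) (x.1, x.2) = Q (a, b)) ∧ x.1 ≠ 0 ∧ x.1 ≠ a ∧
          x.2 ≠ 0 ∧ x.2 ≠ b} := by
      congr 1
      ext ⟨y, z⟩
      simp only [Finset.mem_filter, Finset.mem_univ, true_and, hD]
      change (y ≠ 0 ∧ z ≠ 0 ∧ Q (y, z) = 0) ∧ y - a ≠ 0 ∧ z - b ≠ 0 ∧ Q ((y, z) - (a, b)) = 0 ↔ _
      rw [hsub, sub_ne_zero, sub_ne_zero]
      constructor
      · rintro ⟨⟨h1, h2, h3⟩, h4, h5, h6⟩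
        exact ⟨⟨h3, by rw [h3] at h6; linear_combination -h6⟩, h1, h4, h2, h5⟩
      · rintro ⟨⟨h3, h6⟩, h1, h4, h2, h5⟩
        exact ⟨⟨h1, h2, h3⟩, h4, h5, by rw [h3, h6]; ring⟩
    rw [h1, card_sdiff_lines (fun y z => Q (y, z) = 0 ∧ β (a, b) (y, z) = Q (a, b))
      (Ne.symm ha) (Ne.symm hb)]
    -- each of the four lines meets the set of common zeros in a fibre of the trace
    have e1 : (#{z : F | Q (0, z) = 0 ∧ β (a, b) (0, z) = Q (a, b)} : ℤ) = s := by
      rw [← card_trace_mul_fiber hp hn ha (Q (a, b))]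
      simp [hQdef, hβ_apply, mul_comm]
    have e2 : (#{z : F | Q (a, z) = 0 ∧ β (a, b) (a, z) = Q (a, b)} : ℤ) = s := by
      rw [← card_trace_mul_fiber hp hn ha 0]
      simp [hQdef, hβ_apply, mul_comm]
    have e3 : (#{y : F | Q (y, 0) = 0 ∧ β (a, b) (y, 0) = Q (a, b)} : ℤ) = s := by
      rw [← card_trace_mul_fiber hp hn hb (Q (a, b))]
      simp [hQdef, hβ_apply, mul_comm]
    have e4 : (#{y : F | Q (y, b) = 0 ∧ β (a, b) (y, b) = Q (a, b)} : ℤ) = s := by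
      rw [← card_trace_mul_fiber hp hn hb 0]
      simp [hQdef, hβ_apply, mul_comm]
    rw [e1, e2, e3, e4]
    -- the points `(0, b)` and `(a, 0)` are always common zeros, the other two only if `Q (a, b) = 0`
    have e5 : (Q (0, 0) = 0 ∧ β (a, b) (0, 0) = Q (a, b)) ↔ Q (a, b) = 0 := by
      simp [hQdef, hβ_apply, eq_comm]
    have e6 : Q (0, b) = 0 ∧ β (a, b) (0, b) = Q (a, b) := by
      simp [hQdef, hβ_apply, mul_comm]
    have e7 : Q (a, 0) = 0 ∧ β (a, b) (a, 0) = Q (a, b) := by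
      simp [hQdef, hβ_apply]
    have e8 : (Q (a, b) = 0 ∧ β (a, b) (a, b) = Q (a, b)) ↔ Q (a, b) = 0 := by
      simp only [hQdef, hβ_apply, map_add, mul_comm b a, and_iff_left_iff_imp]
      intro h
      rw [h, add_zero]
    simp only [e5, e6, e7, e8, and_self, if_true, Prod.mk.eta]
    ring
  have key := fun v hv => card_common_zeros Q (β v) (hβ v hv) v (hQ v) hp hV (ε := 1)
    (by rw [hc 0, if_pos rfl]; ring) (fun a ha => by rw [hc a, if_neg ha]; ring)
  refine isLatinSRCayley_of_card (by simp [hD]) (fun x hx => ?_) hV ?_ ?_ ?_ ?_ ?_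
  · rw [hD] at hx ⊢
    simpa using hx
  · have h1 : #{x | x ∈ D} =
        #{x : F × F | x.1 ≠ 0 ∧ x.2 ≠ 0 ∧ Algebra.trace K F (x.1 * x.2) = 0} := by
      simp only [hD]
    rw [h1, card_filter_prod fun y z : F => y ≠ 0 ∧ z ≠ 0 ∧ Algebra.trace K F (y * z) = 0]
    have h2 : ∀ y : F, (#{z : F | y ≠ 0 ∧ z ≠ 0 ∧ Algebra.trace K F (y * z) = 0} : ℤ) =
        (s - 1) - if y = 0 then s - 1 else 0 := by
      intro y
      by_cases hy : y = 0
      · simp [hy]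
      · rw [if_neg hy, sub_zero, ← hcard y hy]
        simp [hy]
    push_cast
    rw [Finset.sum_congr rfl fun y _ => h2 y]
    simp [hn]
    ring
  · intro v hv
    obtain ⟨h1, h2, h3⟩ := (hD v).1 hv
    rw [hcommon v h1 h2, key v h2, if_pos h3, if_pos h3]
    ring
  · rintro ⟨a, b⟩ hvD hv
    by_cases ha : a = 0
    · have hb : b ≠ 0 := by
        rintro rfl
        exact hv (by rw [ha]; rfl)
      have h := card_common_hyperbolic_zero hp hn hb
      rw [show (s - 1) ^ 2 - 1 * (s - 1) = (s - 1) * (s - 2) by ring, ← h]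
      congr 2
      ext ⟨y, z⟩
      simp only [Finset.mem_filter, Finset.mem_univ, true_and, hD, ha, Prod.fst_sub, Prod.snd_sub,
        sub_zero, ne_eq, sub_eq_zero]
      tauto
    by_cases hb : b = 0
    · have h := card_common_hyperbolic_zero hp hn ha
      rw [show (s - 1) ^ 2 - 1 * (s - 1) = (s - 1) * (s - 2) by ring, ← h]
      congr 1
      refine Finset.card_equiv (Equiv.prodComm F F) ?_
      rintro ⟨y, z⟩
      simp only [Finset.mem_filter, Finset.mem_univ, true_and, hD, hb, Prod.fst_sub, Prod.snd_sub,
        sub_zero, ne_eq, sub_eq_zero, Equiv.prodComm_apply, Prod.swap_prod_mk, mul_comm z]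
      tauto
    · have hQv : Q (a, b) ≠ 0 := fun h => hvD ((hD _).2 ⟨ha, hb, h⟩)
      rw [hcommon _ ha hb, key _ hb, if_neg hQv, if_neg hQv]
      ring
  · nlinarith
  · nlinarith [mul_nonneg (by omega : 0 ≤ p - 2) (by omega : 0 ≤ s)]
end Hyperbolic

end Counting

/-! ### The lifted Singer sets as quadrics -/

/-- With `N = (|F| - 1) / (|K| - 1)`, the power `ω ^ N` is the norm of `ω`, a nonzero element of `K`,
so it can be pulled out of the trace. -/
theorem trace_mul_pow_eq_zero_iff {K F : Type*} [Field K] [Field F] [Fintype K] [Fintype F]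
    [Algebra K F] {ω : F} (hω : ω ≠ 0) (i t : ℕ) :
    Algebra.trace K F (ω ^ i * (ω ^ ((Fintype.card F - 1) / (Fintype.card K - 1))) ^ t) = 0 ↔
      Algebra.trace K F (ω ^ i) = 0 := by
  have h := FiniteField.algebraMap_norm_eq_pow (K := K) (x := ω)
  rw [Nat.card_eq_fintype_card, Nat.card_eq_fintype_card] at h
  rw [← h, ← map_pow, mul_comm, ← Algebra.smul_def, map_smul, smul_eq_mul, mul_eq_zero,
    or_iff_right (pow_ne_zero _ (Algebra.norm_ne_zero_iff.2 hω))]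

theorem cyclotomic_index_pos {K F : Type*} [Field K] [Field F] [Fintype K] [Fintype F]
    [Algebra K F] : 0 < (Fintype.card F - 1) / (Fintype.card K - 1) :=
  Nat.div_pos (Nat.sub_le_sub_right
    (Fintype.card_le_of_injective _ (algebraMap K F).injective) _)
    (Nat.sub_pos_of_lt Fintype.one_lt_card)

theorem mem_ellipticSet_iff {K F L : Type*} [Field K] [Field F] [Field L] [Fintype K] [Fintype F]
    [Fintype L] [Algebra K F] [Algebra F L] (h2 : Module.finrank F L = 2) {γ : L} {ω : F}
    (hγ : IsPrimitiveElement γ) (hω : algebraMap F L ω = γ ^ (Fintype.card F + 1)) (x : L) :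
    x ∈ ellipticSet γ ((Fintype.card F - 1) / (Fintype.card K - 1))
        (singerSet K ω ((Fintype.card F - 1) / (Fintype.card K - 1))) ↔
      x ≠ 0 ∧ Algebra.trace K F (Algebra.norm F x) = 0 := by
  have hnorm : Algebra.norm F γ = ω := by
    apply (algebraMap F L).injective
    rw [algebraMap_norm_of_finrank_two h2, hω, pow_succ']
  have hω0 : ω ≠ 0 := hnorm ▸ Algebra.norm_ne_zero_iff.2 hγ.1
  simp only [ellipticSet, singerSet, cyclotomicClass, Set.mem_iUnion, Set.mem_ofPred_eq]
  constructor
  · rintro ⟨i, ⟨-, hi⟩, t, rfl⟩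
    refine ⟨mul_ne_zero (pow_ne_zero _ hγ.1) (pow_ne_zero _ (pow_ne_zero _ hγ.1)), ?_⟩
    simp only [map_mul, map_pow, hnorm]
    exact (trace_mul_pow_eq_zero_iff hω0 i t).2 hi
  · rintro ⟨hx, htr⟩
    obtain ⟨j, rfl⟩ := hγ.2 x hx
    set N := (Fintype.card F - 1) / (Fintype.card K - 1) with hN
    have hj : j = j % N + N * (j / N) := (Nat.mod_add_div j N).symm
    refine ⟨j % N, ⟨Nat.mod_lt _ (cyclotomic_index_pos (K := K) (F := F)), ?_⟩, j / N, ?_⟩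
    · rw [map_pow, hnorm, hj, pow_add, pow_mul] at htr
      exact (trace_mul_pow_eq_zero_iff hω0 _ _).1 htr
    · rw [← pow_mul, ← pow_add, ← hj]

theorem mem_hyperbolicSet_iff {K F : Type*} [Field K] [Field F] [Fintype K] [Fintype F]
    [Algebra K F] {ω : F} (hω : IsPrimitiveElement ω) (z : F × F) :
    z ∈ hyperbolicSet ω ((Fintype.card F - 1) / (Fintype.card K - 1))
        (singerSet K ω ((Fintype.card F - 1) / (Fintype.card K - 1))) ↔
      z.1 ≠ 0 ∧ z.2 ≠ 0 ∧ Algebra.trace K F (z.1 * z.2) = 0 := by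
  simp only [hyperbolicSet, singerSet, cyclotomicClass, Set.mem_ofPred_eq, pow_zero, one_mul]
  constructor
  · rintro ⟨_, ⟨t, rfl⟩, y, hy, i, ⟨-, hi⟩, rfl⟩
    refine ⟨hy, mul_ne_zero (mul_ne_zero (inv_ne_zero hy) (pow_ne_zero _ (pow_ne_zero _ hω.1)))
      (pow_ne_zero _ hω.1), ?_⟩
    rw [mul_assoc, mul_inv_cancel_left₀ hy, mul_comm]
    exact (trace_mul_pow_eq_zero_iff hω.1 i t).2 hi
  · rintro ⟨hy, hz, htr⟩
    obtain ⟨j, hj⟩ := hω.2 _ (mul_ne_zero hy hz)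
    set N := (Fintype.card F - 1) / (Fintype.card K - 1) with hN
    have hjN : ω ^ j = ω ^ (j % N) * (ω ^ N) ^ (j / N) := by
      rw [← pow_mul, ← pow_add, Nat.mod_add_div]
    refine ⟨(ω ^ N) ^ (j / N), ⟨_, rfl⟩, z.1, hy, j % N,
      ⟨Nat.mod_lt _ (cyclotomic_index_pos (K := K) (F := F)), ?_⟩, ?_⟩
    · rw [hj, hjN] at htr
      exact (trace_mul_pow_eq_zero_iff hω.1 _ _).1 htr
    · rw [mul_assoc, mul_comm (_ ^ (j / N)), ← hjN, ← hj, inv_mul_cancel_left₀ hy]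

/-! ### Existence of the fields, and the parameters in terms of `q`, `m`, `d` -/

theorem exists_isPrimitiveElement (F : Type*) [Field F] [Finite F] :
    ∃ ω : F, IsPrimitiveElement ω := by
  obtain ⟨g, hg⟩ := IsCyclic.exists_monoid_generator (α := Fˣ)
  refine ⟨g, g.ne_zero, fun x hx => ?_⟩
  obtain ⟨t, ht⟩ := Submonoid.mem_powers_iff _ _ |>.1 (hg (Units.mk0 x hx))
  exact ⟨t, by simpa using (congrArg Units.val ht).symm⟩

theorem exists_field_tower {q d m : ℕ} (hq : IsPrimePow q) (hd0 : 0 < d) (hd : d ∣ m) (hm : 0 < m) :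
    ∃ (K F L : Type) (_ : Field K) (_ : Field F) (_ : Field L) (_ : Fintype K) (_ : Fintype F)
      (_ : Fintype L) (_ : Algebra K F) (_ : Algebra F L), Fintype.card K = q ^ d ∧
      Fintype.card F = q ^ m ∧ Fintype.card L = q ^ (2 * m) := by
  obtain ⟨ℓ, k, hℓ, hk, rfl⟩ := hq
  have : Fact ℓ.Prime := ⟨hℓ.nat_prime⟩
  obtain ⟨e, rfl⟩ := hd
  have : NeZero e := ⟨(Nat.pos_of_mul_pos_left hm).ne'⟩
  let K := GaloisField ℓ (k * d)
  let F := FiniteField.Extension K ℓ e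
  have : CharP F ℓ := charP_of_injective_algebraMap (algebraMap K F).injective ℓ
  let L := FiniteField.Extension F ℓ 2
  have hK : Nat.card K = ℓ ^ (k * d) := GaloisField.card ℓ _ (by positivity)
  have hF : Nat.card F = Nat.card K ^ e := FiniteField.natCard_extension K ℓ e
  have hL : Nat.card L = Nat.card F ^ 2 := FiniteField.natCard_extension F ℓ 2
  refine ⟨K, F, L, inferInstance, inferInstance, inferInstance, Fintype.ofFinite K,
    Fintype.ofFinite F, Fintype.ofFinite L, inferInstance, inferInstance, ?_, ?_, ?_⟩
  · rw [Fintype.card_eq_nat_card, hK, pow_mul]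
  · rw [Fintype.card_eq_nat_card, hF, hK, ← pow_mul, ← pow_mul, mul_assoc]
  · rw [Fintype.card_eq_nat_card, hL, hF, hK, ← pow_mul, ← pow_mul, ← pow_mul]
    ring_nf

theorem finrank_eq_two {q m : ℕ} {F L : Type*} [Field F] [Field L] [Fintype F] [Fintype L]
    [Algebra F L] (hF : Fintype.card F = q ^ m) (hL : Fintype.card L = q ^ (2 * m)) :
    Module.finrank F L = 2 := by
  refine Nat.pow_right_injective (Fintype.one_lt_card : 2 ≤ Fintype.card F) ?_
  simp only
  rw [← Module.card_eq_pow_finrank, hL, hF]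
  ring

theorem isLatinSRCayley_ellipticSet {q m d : ℕ} (hq : 2 ≤ q) (hdm : d < m) {K F L : Type*}
    [Field K] [Field F] [Field L] [Fintype K] [Fintype F] [Fintype L] [Algebra K F] [Algebra F L]
    {γ : L} {ω : F} (hK : Fintype.card K = q ^ d) (hF : Fintype.card F = q ^ m)
    (hL : Fintype.card L = q ^ (2 * m)) (hγ : IsPrimitiveElement γ)
    (hω : algebraMap F L ω = γ ^ (q ^ m + 1)) :
    IsLatinSRCayley (ellipticSet γ ((q ^ m - 1) / (q ^ d - 1))
      (singerSet K ω ((q ^ m - 1) / (q ^ d - 1)))) (-1) ((q : ℤ) ^ m) ((q : ℤ) ^ (m - d) - 1) := by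
  have hm : (q : ℤ) ^ m = (q : ℤ) ^ d * (q : ℤ) ^ (m - d) := by
    rw [← pow_add, Nat.add_sub_cancel' hdm.le]
  have h2 : Module.finrank F L = 2 := finrank_eq_two hF hL
  rw [hm, ← hK, ← hF]
  rw [← hF] at hω
  refine isLatinSRCayley_elliptic (K := K) h2 (by simp [hK]) (by simp [hF, hm]) ?_
    (mem_ellipticSet_iff h2 hγ hω)
  exact_mod_cast hq.trans (Nat.le_self_pow (Nat.sub_pos_of_lt hdm).ne' q)

theorem isLatinSRCayley_hyperbolicSet {q m d : ℕ} (hq : 2 ≤ q) (hdm : d < m) {K F : Type*}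
    [Field K] [Field F] [Fintype K] [Fintype F] [Algebra K F] {ω : F}
    (hK : Fintype.card K = q ^ d) (hF : Fintype.card F = q ^ m) (hω : IsPrimitiveElement ω) :
    IsLatinSRCayley (hyperbolicSet ω ((q ^ m - 1) / (q ^ d - 1))
      (singerSet K ω ((q ^ m - 1) / (q ^ d - 1)))) 1 ((q : ℤ) ^ m) ((q : ℤ) ^ (m - d) - 1) := by
  have hm : (q : ℤ) ^ m = (q : ℤ) ^ d * (q : ℤ) ^ (m - d) := by
    rw [← pow_add, Nat.add_sub_cancel' hdm.le]
  rw [hm, ← hK, ← hF]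
  refine isLatinSRCayley_hyperbolic (K := K) (by simp [hK]) (by simp [hF, hm]) ?_
    (mem_hyperbolicSet_iff hω)
  exact_mod_cast hq.trans (Nat.le_self_pow (Nat.sub_pos_of_lt hdm).ne' q)

end SingerLift

theorem corollary3p5 {q m d : ℕ} (hq : IsPrimePow q) (hm : 3 ≤ m) (hd : d ∣ m) (hdm : d < m) :
    -- for both signs there is a strongly regular Cayley graph with the stated parameters
    (∀ ε : ℤ, ε = 1 ∨ ε = -1 →
      ∃ (G : Type) (_ : AddCommGroup G) (_ : Fintype G) (D : Set G),
        SingerLift.IsLatinSRCayley D ε ((q : ℤ) ^ m) ((q : ℤ) ^ (m - d) - 1)) ∧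
    -- `ε = -1`: the elliptic lifting of the subfield example, over `K = 𝔽_{q^d} ⊆ F = 𝔽_{q^m} ⊆ L`
    (∀ (K F L : Type*) [Field K] [Field F] [Field L] [Fintype K] [Fintype F] [Fintype L]
      [Algebra K F] [Algebra F L] (γ : L) (ω : F),
      Fintype.card K = q ^ d → Fintype.card F = q ^ m → Fintype.card L = q ^ (2 * m) →
      SingerLift.IsPrimitiveElement γ → algebraMap F L ω = γ ^ (q ^ m + 1) →
      SingerLift.IsLatinSRCayley
        (SingerLift.ellipticSet γ ((q ^ m - 1) / (q ^ d - 1))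
          (SingerLift.singerSet K ω ((q ^ m - 1) / (q ^ d - 1))))
        (-1) ((q : ℤ) ^ m) ((q : ℤ) ^ (m - d) - 1)) ∧
    -- `ε = 1`: the hyperbolic lifting of the subfield example, over `K = 𝔽_{q^d} ⊆ F = 𝔽_{q^m}`
    (∀ (K F : Type*) [Field K] [Field F] [Fintype K] [Fintype F] [Algebra K F] (ω : F),
      Fintype.card K = q ^ d → Fintype.card F = q ^ m →
      SingerLift.IsPrimitiveElement ω →
      SingerLift.IsLatinSRCayley
        (SingerLift.hyperbolicSet ω ((q ^ m - 1) / (q ^ d - 1))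
          (SingerLift.singerSet K ω ((q ^ m - 1) / (q ^ d - 1))))
        1 ((q : ℤ) ^ m) ((q : ℤ) ^ (m - d) - 1)) := by
  have hd0 : 0 < d := Nat.pos_of_dvd_of_pos hd (by omega)
  have hq2 : 2 ≤ q := hq.two_le
  refine ⟨fun ε hε => ?_, fun K F L _ _ _ _ _ _ _ _ γ ω hK hF hL hγ hω =>
    SingerLift.isLatinSRCayley_ellipticSet hq2 hdm hK hF hL hγ hω, fun K F _ _ _ _ _ ω hK hF hω =>
    SingerLift.isLatinSRCayley_hyperbolicSet hq2 hdm hK hF hω⟩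
  obtain ⟨K, F, L, _, _, _, _, _, _, _, _, hK, hF, hL⟩ :=
    SingerLift.exists_field_tower hq hd0 hd (by omega)
  rcases hε with rfl | rfl
  · obtain ⟨ω, hω⟩ := SingerLift.exists_isPrimitiveElement F
    exact ⟨_, _, _, _, SingerLift.isLatinSRCayley_hyperbolicSet (K := K) hq2 hdm hK hF hω⟩
  · obtain ⟨γ, hγ⟩ := SingerLift.exists_isPrimitiveElement L
    have hω : algebraMap F L (Algebra.norm F γ) = γ ^ (q ^ m + 1) := by
      rw [SingerLift.algebraMap_norm_of_finrank_two (SingerLift.finrank_eq_two hF hL), hF, pow_succ']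
    exact ⟨_, _, _, _, SingerLift.isLatinSRCayley_ellipticSet (K := K) hq2 hdm hK hF hL hγ hω⟩
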